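/- **Proposition 1 (synchronization conditions).** Let $A\in\mathbb R^{n\times n}$, $B\in\mathbb R^{n\times m}$, $K\in\mathbb R^{m\times n}$, and let $\mathcal G$ be a directed graph on $N$ nodes with weight matrix $\mathcal W\in\mathbb R^{N\times N}$, $\mathcal W_{ij}\ge 0$ ($\mathcal W_{ij}>0$ meaning that agent $i$ receives information from agent $j$), which is connected in the sense that it contains a directed spanning tree (some node has a directed path to every other node). Let $L=\operatorname{diag}(\mathcal W\mathbf 1_N)-\mathcal W$ be its Laplacian and let $\lambda_1,\dots,\lambda_\nu\in\mathbb C$ be its nonzero eigenvalues (of each complex conjugate pair, it suffices to list one). Consider the $N$ identical agents $\dot x_i=Ax_i+Bu_i$ with the coupling $u=-(L\otimes K)x$, where $x=(x_1,\dots,x_N)$ and $u=(u_1,\dots,u_N)$, and the synchronization set $\mathcal A=\{x: x_i=x_j\ \forall i,j\}$. For $\mu>0$, the set $\mathcal A$ is called $\mu$-UGES if there is $M>0$ such that $|x(t)|_{\mathcal A}\le M e^{-\mu t}|x(0)|_{\mathcal A}$ for all $t\ge 0$ and every solution $x$, where $|\cdot|_{\mathcal A}$ is the Euclidean distance from $\mathcal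 A$. Write $\operatorname{He}(X)=X+X^\top$ for real $X$; the spectral abscissa of a matrix is the largest real part of its eigenvalues. For $\mu>0$ consider the conditions: 1. (Complex condition) For $k=1,\dots,\nu$, the matrix $A_k:=A-\lambda_kBK$ has spectral abscissa smaller than $-\mu$. 2. (Real condition) For $k=1,\dots,\nu$, the matrix $$A_{e,k}:=\begin{bmatrix}A-\Re(\lambda_k)BK & \Im(\lambda_k)BK\\ -\Im(\lambda_k)BK & A-\Re(\lambda_k)BK\end{bmatrix}$$ has spectral abscissa smaller than $-\mu$. 3. (Lyapunov inequality) For each $k=1,\dots,\nu$ there exist real matrices $P_k=P_k^\top\succ0$ and $\Pi_k=-\Pi_k^\top$ such that $P_{e,k}:=\begin{bmatrix}P_k&-\Pi_k\\ \Pi_k&P_k\end{bmatrix}\succ0$ satisfies $\operatorname{He}(P_{e,k}A_{e,k})\prec-2\mu P_{e,k}$. Then, for every $\mu>0$, conditions 1, 2 and 3 are equivalent to each other, and each of them holds if and only if $\mathcal A$ is $\mu'$-UGES for some $\mu'>\mu$. Moreover, unless $-\mu$ is exactly equal to the largest of the spectral abscissas of $A_1,\dots,A_\nu$, each of the three conditions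 holds if and only if $\mathcal A$ is $\mu$-UGES. -/

import Mathlib

open scoped Matrix Kronecker

namespace Synchronization

/-- The Laplacian `L = diag(W 1) - W` of a directed graph with weight matrix `W`. -/
def laplacian {N : ℕ} (W : Matrix (Fin N) (Fin N) ℝ) : Matrix (Fin N) (Fin N) ℝ :=
  Matrix.diagonal (W *ᵥ fun _ => 1) - W

/-- Connectedness of the directed graph with weight matrix `W`: it contains a directed spanning
tree. Here `0 < W i j` with `i ≠ j` means that there is an edge from `j` to `i`, i.e. agent `i`
receives information from agent `j` (self-loops play no role). -/
def HasSpanningTree {N : ℕ} (W : Matrix (Fin N) (Fin N) ℝ) : Prop :=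
  ∃ r : Fin N, ∀ i : Fin N, Relation.ReflTransGen (fun j i : Fin N => 0 < W i j) r i

/-- A real matrix regarded as a complex one. -/
def toComplex {ι κ : Type*} (M : Matrix ι κ ℝ) : Matrix ι κ ℂ :=
  M.map Complex.ofReal

/-- `lam` lists the nonzero eigenvalues of the real matrix `L`, where from each pair of complex
conjugate eigenvalues at least one has to be listed. -/
def ListsNonzeroEigenvalues {N ν : ℕ} (L : Matrix (Fin N) (Fin N) ℝ) (lam : Fin ν → ℂ) : Prop :=
  (∀ k, lam k ≠ 0 ∧ lam k ∈ spectrum ℂ (toComplex L)) ∧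
    ∀ z ∈ spectrum ℂ (toComplex L), z ≠ 0 → ∃ k, z = lam k ∨ z = starRingEnd ℂ (lam k)

/-- The spectral abscissa: the largest real part of an eigenvalue (`⊥` for the matrix of
size zero). -/
noncomputable def spectralAbscissa {ι : Type*} [Fintype ι] [DecidableEq ι]
    (M : Matrix ι ι ℂ) : EReal :=
  ⨆ z ∈ spectrum ℂ M, ((z.re : ℝ) : EReal)

/-- The aggregate state `x = (x_1, …, x_N)`, with the Euclidean norm; `x (i, a)` is the `a`-th
component of the state of agent `i`. -/
abbrev State (N n : ℕ) : Type := EuclideanSpace ℝ (Fin N × Fin n)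

/-- The aggregate input `u = -(L ⊗ K) x`. -/
def diffusiveInput {N n m : ℕ} (W : Matrix (Fin N) (Fin N) ℝ) (K : Matrix (Fin m) (Fin n) ℝ)
    (x : State N n) : Fin N × Fin m → ℝ :=
  -((laplacian W ⊗ₖ K) *ᵥ fun p => x p)

/-- `x` is a trajectory on `[0, ∞)` of the agents `ẋ_i = A x_i + B u_i` under the coupling
`u = -(L ⊗ K) x`. -/
def IsTrajectory {N n m : ℕ} (A : Matrix (Fin n) (Fin n) ℝ) (B : Matrix (Fin n) (Fin m) ℝ)
    (K : Matrix (Fin m) (Fin n) ℝ) (W : Matrix (Fin N) (Fin N) ℝ) (x : ℝ → State N n) : Prop :=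
  ∀ t : ℝ, 0 ≤ t → ∀ (i : Fin N) (a : Fin n),
    HasDerivWithinAt (fun s => x s (i, a))
      ((A *ᵥ fun b => x t (i, b)) a + (B *ᵥ fun c => diffusiveInput W K (x t) (i, c)) a)
      (Set.Ici 0) t

/-- The synchronization set `{x : x_i = x_j for all i, j}`. -/
def syncSet (N n : ℕ) : Set (State N n) :=
  {x | ∀ (i j : Fin N) (a : Fin n), x (i, a) - x (j, a) = 0}

/-- The synchronization set is `μ`-UGES (uniformly globally exponentially stable with rate `μ`)
for the network. -/
def IsUGES {N n m : ℕ} (A : Matrix (Fin n) (Fin n) ℝ) (B : Matrix (Fin n) (Fin m) ℝ)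
    (K : Matrix (Fin m) (Fin n) ℝ) (W : Matrix (Fin N) (Fin N) ℝ) (μ : ℝ) : Prop :=
  ∃ M : ℝ, 0 < M ∧ ∀ x : ℝ → State N n, IsTrajectory A B K W x → ∀ t : ℝ, 0 ≤ t →
    Metric.infDist (x t) (syncSet N n) ≤
      M * Real.exp (-μ * t) * Metric.infDist (x 0) (syncSet N n)

/-- `A_k = A - λ_k B K`. -/
noncomputable def complexMode {n m : ℕ} (A : Matrix (Fin n) (Fin n) ℝ)
    (B : Matrix (Fin n) (Fin m) ℝ) (K : Matrix (Fin m) (Fin n) ℝ) (z : ℂ) :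
    Matrix (Fin n) (Fin n) ℂ :=
  toComplex A - z • toComplex (B * K)

/-- The real `2n × 2n` matrix `A_{e,k}`. -/
def liftedMode {n m : ℕ} (A : Matrix (Fin n) (Fin n) ℝ)
    (B : Matrix (Fin n) (Fin m) ℝ) (K : Matrix (Fin m) (Fin n) ℝ) (z : ℂ) :
    Matrix (Fin n ⊕ Fin n) (Fin n ⊕ Fin n) ℝ :=
  Matrix.fromBlocks (A - z.re • (B * K)) (z.im • (B * K))
    (-(z.im • (B * K))) (A - z.re • (B * K))

/-- The structured matrix `P_{e,k}`, with blocks `P, -Q` over `Q, P`. -/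
def liftedLyap {n : ℕ} (P Q : Matrix (Fin n) (Fin n) ℝ) :
    Matrix (Fin n ⊕ Fin n) (Fin n ⊕ Fin n) ℝ :=
  Matrix.fromBlocks P (-Q) Q P

/-- `He X = X + X*`; for real matrices the conjugate transpose is the transpose. -/
def He {ι : Type*} (X : Matrix ι ι ℝ) : Matrix ι ι ℝ := X + Xᵀ

/-- The strict Loewner order on real matrices: `Y - X` is symmetric positive definite. -/
def LoewnerLT {ι : Type*} [Fintype ι] (X Y : Matrix ι ι ℝ) : Prop := (Y - X).PosDef

/-- Complex condition: every `A_k` has spectral abscissa smaller than `-μ`. -/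
def ComplexCondition {n m ν : ℕ} (A : Matrix (Fin n) (Fin n) ℝ) (B : Matrix (Fin n) (Fin m) ℝ)
    (K : Matrix (Fin m) (Fin n) ℝ) (lam : Fin ν → ℂ) (μ : ℝ) : Prop :=
  ∀ k, spectralAbscissa (complexMode A B K (lam k)) < ((-μ : ℝ) : EReal)

/-- Real condition: every `A_{e,k}` has spectral abscissa smaller than `-μ`. -/
def RealCondition {n m ν : ℕ} (A : Matrix (Fin n) (Fin n) ℝ) (B : Matrix (Fin n) (Fin m) ℝ)
    (K : Matrix (Fin m) (Fin n) ℝ) (lam : Fin ν → ℂ) (μ : ℝ) : Prop :=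
  ∀ k, spectralAbscissa (toComplex (liftedMode A B K (lam k))) < ((-μ : ℝ) : EReal)

/-- Lyapunov inequality: for each `k` there are `P = Pᵀ ≻ 0` and `Q = -Qᵀ` such that the
structured matrix `P_e` is positive definite and `He (P_e A_{e,k}) ≺ -2 μ P_e`. -/
def LyapunovCondition {n m ν : ℕ} (A : Matrix (Fin n) (Fin n) ℝ) (B : Matrix (Fin n) (Fin m) ℝ)
    (K : Matrix (Fin m) (Fin n) ℝ) (lam : Fin ν → ℂ) (μ : ℝ) : Prop :=
  ∀ k, ∃ P Q : Matrix (Fin n) (Fin n) ℝ, P.PosDef ∧ Qᵀ = -Q ∧ (liftedLyap P Q).PosDef ∧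
    LoewnerLT (He (liftedLyap P Q * liftedMode A B K (lam k))) ((-2 * μ) • liftedLyap P Q)

end Synchronization

open Synchronization

/-! Fix a root `r` of the graph. Since the rows of `L` sum to zero, the differences `x_i - x_r` obey
an autonomous linear system with matrix `1 ⊗ A - R ⊗ BK`, where `R i j = L i j - L r j` for `i, j ≠
r`, and their size is comparable to the distance from the synchronization set. By a maximum
principle, which uses the spanning tree, every eigenvalue `z` of `R` is a nonzero eigenvalue of `L`
(`spectrum_reducedLaplacian`). As `R ⊗ 1` commutes with the error matrix, common eigenvectors show
that each error eigenvalue belongs to a mode `A - z BK` (`exists_mode_of_mem_spectrum`). Finite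
spectra leave room for a rate `β > μ`, and Gelfand's formula turns the spectral bound into
exponential decay (`exists_norm_exp_le`).

Conversely, eigenvectors `v` of `L` and `w` of a mode yield the trajectories `Re (c exp (s t) v ⊗
w)`, so `μ`-UGES forces `Re s ≤ -μ` (`IsUGES.re_le`). The inequality is not strict; strictness comes
from a larger rate `μ'`, or from excluding the boundary value.

The three conditions are linked in a cycle. A stable complex mode has the Lyapunov matrix `∫ exp (t
M)ᴴ exp (t M)` (after a shift by `μ`), whose real and imaginary parts form the structured real
solution. A Lyapunov inequality bounds the lifted spectrum, and that spectrum contains the complex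
one. -/

namespace Synchronization

open scoped ComplexOrder

/-! ### Exponential decay and the Lyapunov equation in Banach algebras. -/

section BanachAlgebra

open Filter Topology

variable {𝔸 : Type*} [NormedRing 𝔸] [NormedAlgebra ℂ 𝔸] [CompleteSpace 𝔸]

theorem exp_real_add_smul (a : 𝔸) (s t : ℝ) :
    NormedSpace.exp ((s + t) • a) = NormedSpace.exp (s • a) * NormedSpace.exp (t • a) := by
  let _ : NormedAlgebra ℚ 𝔸 := NormedAlgebra.restrictScalars ℚ ℂ 𝔸
  rw [add_smul]
  exact NormedSpace.exp_add_of_commute (((Commute.refl a).smul_left s).smul_right t)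

theorem continuous_exp_real_smul (a : 𝔸) : Continuous fun t : ℝ => NormedSpace.exp (t • a) :=
  continuous_iff_continuousAt.2 fun t => (hasDerivAt_exp_smul_const a t).continuousAt

/-- A submultiplicative continuous function on the half line that is at most one at some positive
integer is bounded. -/
theorem exists_bound_of_submultiplicative {g : ℝ → ℝ} (hg : Continuous g) (h0 : ∀ t, 0 ≤ g t)
    (hmul : ∀ s t, g (s + t) ≤ g s * g t) {k : ℕ} (hk : 0 < k) (hk1 : g k ≤ 1) :
    ∃ C : ℝ, 0 < C ∧ ∀ t, 0 ≤ t → g t ≤ C := by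
  obtain ⟨C, hC⟩ := (isCompact_Icc (a := (0 : ℝ)) (b := k)).bddAbove_image hg.continuousOn
  have hper : ∀ (q : ℕ) (s : ℝ), g (s + q * k) ≤ g s := by
    intro q
    induction q with
    | zero => intro s; simp
    | succ q ih =>
      intro s
      have h1 : s + ((q + 1 : ℕ) : ℝ) * k = (s + q * k) + k := by push_cast; ring
      rw [h1]
      calc g ((s + q * k) + k) ≤ g (s + q * k) * g k := hmul _ _
        _ ≤ g (s + q * k) * 1 := by gcongr; exact h0 _
        _ ≤ g s := by rw [mul_one]; exact ih s
  refine ⟨max C 1, lt_max_of_lt_right one_pos, fun t ht => ?_⟩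
  have hkpos : (0 : ℝ) < k := by exact_mod_cast hk
  set q := ⌊t / k⌋₊
  have h1 : (q : ℝ) * k ≤ t := by
    have := Nat.floor_le (div_nonneg ht hkpos.le)
    rwa [le_div_iff₀ hkpos] at this
  have h2 : t ≤ (q + 1) * k := by
    have := (Nat.lt_floor_add_one (t / k)).le
    rwa [div_le_iff₀ hkpos] at this
  have h3 := hper q (t - q * k)
  rw [sub_add_cancel] at h3
  refine h3.trans ((hC (Set.mem_image_of_mem g ⟨?_, ?_⟩)).trans (le_max_left _ _)) <;> linarith

/-- If the spectrum of `exp a` lies in the open disc of radius `exp (-β)`, then `exp (t a)` decays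
with rate `β`. -/
theorem exists_norm_exp_le [Nontrivial 𝔸] (a : 𝔸) (β : ℝ)
    (h : ∀ z ∈ spectrum ℂ (NormedSpace.exp a), ‖z‖ < Real.exp (-β)) :
    ∃ C : ℝ, 0 < C ∧ ∀ t : ℝ, 0 ≤ t → ‖NormedSpace.exp (t • a)‖ ≤ C * Real.exp (-β * t) := by
  let _ : NormedAlgebra ℚ 𝔸 := NormedAlgebra.restrictScalars ℚ ℂ 𝔸
  have hr : spectralRadius ℂ (NormedSpace.exp a) <
      ((Real.toNNReal (Real.exp (-β)) : NNReal) : ENNReal) :=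
    spectrum.spectralRadius_lt_of_forall_lt _ fun z hz => by
      rw [← NNReal.coe_lt_coe, Real.coe_toNNReal _ (Real.exp_pos _).le]; exact h z hz
  have hev := (spectrum.pow_nnnorm_pow_one_div_tendsto_nhds_spectralRadius
    (NormedSpace.exp a)).eventually_lt_const hr
  -- Gelfand's formula gives a single time `k` at which the norm is at most `exp (-β k)`;
  -- submultiplicativity of `exp (β t) ‖exp (t a)‖` propagates this to all times.
  obtain ⟨k, hk, hkpos⟩ := (hev.and (eventually_gt_atTop 0)).exists
  have hk1 : ‖NormedSpace.exp a ^ k‖ ≤ Real.exp (-β) ^ k := by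
    have hkr : (0 : ℝ) < k := by exact_mod_cast hkpos
    have h1 := ENNReal.rpow_le_rpow hk.le hkr.le
    rw [← ENNReal.rpow_mul, one_div, inv_mul_cancel₀ hkr.ne', ENNReal.rpow_one,
      ENNReal.rpow_natCast, ← ENNReal.coe_pow, ENNReal.coe_le_coe, ← NNReal.coe_le_coe] at h1
    simpa [(Real.exp_pos (-β)).le] using h1
  have hexp : NormedSpace.exp ((k : ℝ) • a) = NormedSpace.exp a ^ k := by
    rw [← NormedSpace.exp_nsmul, Nat.cast_smul_eq_nsmul]
  obtain ⟨C, hC, hCb⟩ := exists_bound_of_submultiplicative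
    (g := fun t => Real.exp (β * t) * ‖NormedSpace.exp (t • a)‖)
    ((by fun_prop : Continuous fun t : ℝ => Real.exp (β * t)).mul
      (continuous_exp_real_smul a).norm)
    (fun t => by positivity)
    (fun s t => by
      rw [exp_real_add_smul, mul_add, Real.exp_add]
      calc _ ≤ Real.exp (β * s) * Real.exp (β * t) *
            (‖NormedSpace.exp (s • a)‖ * ‖NormedSpace.exp (t • a)‖) := by
              gcongr; exact norm_mul_le _ _
        _ = _ := by ring)
    hkpos
    (by
      rw [hexp]
      calc _ ≤ Real.exp (β * k) * Real.exp (-β) ^ k := by gcongr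
        _ = 1 := by
          rw [← Real.exp_nat_mul, ← Real.exp_add]; simp [mul_comm])
  refine ⟨C, hC, fun t ht => ?_⟩
  have := hCb t ht
  calc ‖NormedSpace.exp (t • a)‖
      = Real.exp (β * t) * ‖NormedSpace.exp (t • a)‖ * Real.exp (-β * t) := by
        rw [mul_right_comm, ← Real.exp_add]; simp
    _ ≤ _ := by gcongr

/-- The integral of `exp (t a)* exp (t a)` solves the Lyapunov equation of a stable element. -/
theorem exists_lyapunov_solution [StarRing 𝔸] [CStarRing 𝔸] [StarModule ℂ 𝔸] (a : 𝔸)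
    {C β : ℝ} (hβ : 0 < β)
    (h : ∀ t : ℝ, 0 ≤ t → ‖NormedSpace.exp (t • a)‖ ≤ C * Real.exp (-β * t)) :
    ∃ p : 𝔸, star a * p + p * a = -1 ∧ star p = p ∧
      ∀ φ : 𝔸 →L[ℂ] ℂ, (∀ b, 0 ≤ φ (star b * b)) → 0 ≤ φ p := by
  set e : ℝ → 𝔸 := fun t => NormedSpace.exp (t • a) with he
  set f : ℝ → 𝔸 := fun t => star (e t) * e t with hf
  have hcont : Continuous e := continuous_exp_real_smul a
  have hfcont : Continuous f := hcont.star.mul hcont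
  have hfle : ∀ t, 0 ≤ t → ‖f t‖ ≤ C ^ 2 * Real.exp ((-2 * β) * t) := fun t ht => by
    calc ‖f t‖ ≤ ‖star (e t)‖ * ‖e t‖ := norm_mul_le _ _
      _ = ‖e t‖ * ‖e t‖ := by rw [norm_star]
      _ ≤ (C * Real.exp (-β * t)) * (C * Real.exp (-β * t)) :=
        mul_self_le_mul_self (norm_nonneg _) (h t ht)
      _ = C ^ 2 * (Real.exp (-β * t) * Real.exp (-β * t)) := by ring
      _ = _ := by rw [← Real.exp_add]; ring_nf
  have hint : MeasureTheory.IntegrableOn f (Set.Ioi 0) := by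
    refine ((integrableOn_exp_mul_Ioi (a := -2 * β) (by linarith) 0).const_mul (C ^ 2)).mono'
      hfcont.aestronglyMeasurable ?_
    filter_upwards [MeasureTheory.ae_restrict_mem measurableSet_Ioi] with t ht
      using hfle t (le_of_lt ht)
  have htend : Tendsto f atTop (𝓝 0) := by
    refine squeeze_zero_norm' (eventually_ge_atTop 0 |>.mono hfle) ?_
    have h1 : Tendsto (fun t : ℝ => (-2 * β) * t) atTop atBot :=
      tendsto_id.const_mul_atTop_of_neg (by linarith)
    simpa using (Real.tendsto_exp_atBot.comp h1).const_mul (C ^ 2)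
  have hder : ∀ t, HasDerivAt f (star a * f t + f t * a) t := by
    intro t
    have h1 : HasDerivAt e (e t * a) t := hasDerivAt_exp_smul_const a t
    refine (h1.star.mul h1).congr_deriv ?_
    rw [star_mul, hf]
    simp only [mul_assoc]
  -- Integrating `f' = a* f + f a` over the half line gives `-f 0 = -1`. Positivity is stated
  -- through functionals because these commute with the integral.
  refine ⟨∫ t in Set.Ioi 0, f t, ?_, ?_, fun φ hφ => ?_⟩
  · have h1 := hint.integrable.const_mul (star a)
    have h2 := hint.integrable.mul_const a
    have h3 := MeasureTheory.integral_Ioi_of_hasDerivAt_of_tendsto' (a := 0)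
      (fun t _ => hder t) (h1.add h2) htend
    have h4 := ((ContinuousLinearMap.mul ℝ 𝔸) (star a)).integral_comp_comm hint
    have h5 := ((ContinuousLinearMap.mul ℝ 𝔸).flip a).integral_comp_comm hint
    simp only [ContinuousLinearMap.mul_apply', ContinuousLinearMap.flip_apply] at h4 h5
    rw [MeasureTheory.integral_add h1 h2, h4, h5] at h3
    rw [h3]
    simp [hf, he]
  · have h1 := (starL' ℝ : 𝔸 ≃L[ℝ] 𝔸).integral_comp_comm
      (μ := MeasureTheory.volume.restrict (Set.Ioi 0)) f
    simp only [starL'_apply] at h1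
    rw [← h1]
    simp [hf]
  · rw [← φ.integral_comp_comm hint]
    exact MeasureTheory.integral_nonneg fun t => hφ (e t)

end BanachAlgebra

/-! ### Spectra and Lyapunov inequalities of complex matrices. -/

section ComplexMatrix

open scoped Matrix.Norms.L2Operator

variable {ι : Type*} [Fintype ι] [DecidableEq ι]

theorem mem_spectrum_iff_exists_mulVec {M : Matrix ι ι ℂ} {z : ℂ} :
    z ∈ spectrum ℂ M ↔ ∃ v, v ≠ 0 ∧ M *ᵥ v = z • v := by
  rw [← Matrix.spectrum_toLin', ← Module.End.hasEigenvalue_iff_mem_spectrum]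
  constructor
  · intro h
    obtain ⟨v, hv⟩ := h.exists_hasEigenvector
    exact ⟨v, hv.2, by simpa using hv.apply_eq_smul⟩
  · rintro ⟨v, hv0, hv⟩
    exact Module.End.hasEigenvalue_of_hasEigenvector
      (Module.End.hasEigenvector_iff.2 ⟨Module.End.mem_eigenspace_iff.2 (by simpa using hv), hv0⟩)

/-- An eigenspace of a matrix contains an eigenvector of every commuting matrix. -/
theorem exists_common_eigenvector {S T : Matrix ι ι ℂ} (h : Commute S T) {z : ℂ}
    (hz : z ∈ spectrum ℂ S) :
    ∃ w : ℂ, ∃ v, v ≠ 0 ∧ S *ᵥ v = z • v ∧ T *ᵥ v = w • v := by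
  obtain ⟨v, hv0, hv⟩ := mem_spectrum_iff_exists_mulVec.1 hz
  let E := Module.End.eigenspace (Matrix.toLin' S) z
  have hmaps : ∀ x ∈ E, Matrix.toLin' T x ∈ E := by
    intro x hx
    rw [Module.End.mem_eigenspace_iff, Matrix.toLin'_apply] at hx ⊢
    rw [Matrix.toLin'_apply, Matrix.mulVec_mulVec, h.eq, ← Matrix.mulVec_mulVec, hx,
      Matrix.mulVec_smul]
  have hvE : v ∈ E := Module.End.mem_eigenspace_iff.2 (by simpa using hv)
  have : Nontrivial E := ⟨⟨v, hvE⟩, 0, fun h0 => hv0 (congrArg Subtype.val h0)⟩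
  obtain ⟨w, hw⟩ := Module.End.exists_eigenvalue ((Matrix.toLin' T).restrict hmaps)
  obtain ⟨u, hu⟩ := hw.exists_hasEigenvector
  refine ⟨w, u, fun h0 => hu.2 (Subtype.ext h0), ?_, ?_⟩
  · simpa using Module.End.mem_eigenspace_iff.1 u.2
  · simpa using congrArg Subtype.val hu.apply_eq_smul

theorem exp_mulVec_of_mulVec_eq_smul {M : Matrix ι ι ℂ} {v : ι → ℂ} {z : ℂ}
    (h : M *ᵥ v = z • v) : NormedSpace.exp M *ᵥ v = Complex.exp z • v := by
  have hpow : ∀ k : ℕ, (M ^ k) *ᵥ v = z ^ k • v := by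
    intro k
    induction k with
    | zero => simp
    | succ k ih =>
      rw [pow_succ, ← Matrix.mulVec_mulVec, h, Matrix.mulVec_smul, ih, smul_smul, pow_succ,
        mul_comm]
  let φ : Matrix ι ι ℂ →ₗ[ℂ] (ι → ℂ) :=
    { toFun := fun X => X *ᵥ v
      map_add' := fun X Y => Matrix.add_mulVec X Y v
      map_smul' := fun c X => Matrix.smul_mulVec c X v }
  have h1 := (NormedSpace.exp_series_hasSum_exp' (𝕂 := ℂ) M).mapL
    (LinearMap.toContinuousLinearMap φ)
  have h2 := (NormedSpace.exp_series_hasSum_exp' (𝕂 := ℂ) z).smul_const v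
  rw [← Complex.exp_eq_exp_ℂ] at h2
  have h3 : (fun k : ℕ => LinearMap.toContinuousLinearMap φ ((k.factorial : ℂ)⁻¹ • M ^ k)) =
      fun k : ℕ => ((k.factorial : ℂ)⁻¹ • z ^ k) • v := by
    funext k
    simp [φ, hpow, smul_smul]
  rw [h3] at h1
  exact h1.unique h2

/-- `M` commutes with `exp M`, so the eigenspace of `exp M` for `z` contains an eigenvector of `M`.
-/
theorem exists_eq_exp_of_mem_spectrum_exp {M : Matrix ι ι ℂ} {z : ℂ}
    (hz : z ∈ spectrum ℂ (NormedSpace.exp M)) : ∃ s ∈ spectrum ℂ M, z = Complex.exp s := by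
  obtain ⟨s, v, hv0, hv, hs⟩ :=
    exists_common_eigenvector (T := M) (Commute.exp_left (Commute.refl M)) hz
  refine ⟨s, mem_spectrum_iff_exists_mulVec.2 ⟨v, hv0, hs⟩, ?_⟩
  rw [exp_mulVec_of_mulVec_eq_smul hs] at hv
  exact (smul_left_injective ℂ hv0 hv).symm

theorem exists_gt_forall_re_lt {M : Matrix ι ι ℂ} {μ : ℝ}
    (h : ∀ z ∈ spectrum ℂ M, z.re < -μ) : ∃ β, μ < β ∧ ∀ z ∈ spectrum ℂ M, z.re < -β := by
  have hev : ∀ᶠ β in nhdsWithin μ (Set.Ioi μ), ∀ z ∈ spectrum ℂ M, z.re < -β := by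
    rw [Set.Finite.eventually_all (Matrix.finite_spectrum M)]
    intro z hz
    have h1 : Filter.Tendsto (fun β : ℝ => -β) (nhdsWithin μ (Set.Ioi μ)) (nhds (-μ)) :=
      continuous_neg.continuousWithinAt
    exact h1.eventually_const_lt (h z hz)
  obtain ⟨β, hβ, hμ⟩ := (hev.and self_mem_nhdsWithin).exists
  exact ⟨β, hμ, hβ⟩

theorem exists_norm_matrix_exp_le {M : Matrix ι ι ℂ} {β : ℝ}
    (h : ∀ z ∈ spectrum ℂ M, z.re < -β) :
    ∃ C : ℝ, 0 < C ∧ ∀ t : ℝ, 0 ≤ t →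
      ‖NormedSpace.exp ((t : ℂ) • M)‖ ≤ C * Real.exp (-β * t) := by
  rcases isEmpty_or_nonempty ι with hι | hι
  · refine ⟨1, one_pos, fun t _ => ?_⟩
    rw [Subsingleton.elim (NormedSpace.exp ((t : ℂ) • M)) 0, norm_zero]
    positivity
  · refine exists_norm_exp_le M β fun z hz => ?_
    obtain ⟨s, hs, rfl⟩ := exists_eq_exp_of_mem_spectrum_exp hz
    rw [Complex.norm_exp]
    exact Real.exp_lt_exp.2 (h s hs)

/-- A complex matrix whose eigenvalues have real parts smaller than `-μ` satisfies a strict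
Lyapunov inequality with rate `μ`. -/
theorem exists_complex_lyapunov {M : Matrix ι ι ℂ} {μ : ℝ}
    (h : ∀ z ∈ spectrum ℂ M, z.re < -μ) :
    ∃ P : Matrix ι ι ℂ, P.PosDef ∧
      (-(Mᴴ * P + P * M) - (2 * μ : ℂ) • P).PosDef := by
  obtain ⟨β, hμβ, hβ⟩ := exists_gt_forall_re_lt h
  obtain ⟨C, -, hC⟩ := exists_norm_matrix_exp_le hβ
  -- The shift turns rate `μ` into rate zero: `A` still decays with rate `β - μ > 0`, and `Aᴴ P + P
  -- A = -1` contains the term `2 μ P`.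
  set A : Matrix ι ι ℂ := M + (μ : ℂ) • 1 with hA
  have hdecay : ∀ t : ℝ, 0 ≤ t →
      ‖NormedSpace.exp ((t : ℂ) • A)‖ ≤ C * Real.exp (-(β - μ) * t) := by
    intro t ht
    let _ : NormedAlgebra ℚ (Matrix ι ι ℂ) := NormedAlgebra.restrictScalars ℚ ℂ _
    have h1 : (t : ℂ) • A = (t : ℂ) • M + algebraMap ℂ (Matrix ι ι ℂ) (t * μ) := by
      rw [hA, smul_add, Algebra.algebraMap_eq_smul_one, smul_smul]
    have h2 : NormedSpace.exp (algebraMap ℂ (Matrix ι ι ℂ) (t * μ)) =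
        Complex.exp (t * μ) • 1 := by
      rw [← NormedSpace.algebraMap_exp_comm, ← Complex.exp_eq_exp_ℂ,
        Algebra.algebraMap_eq_smul_one]
    rw [h1, NormedSpace.exp_add_of_commute (Algebra.commutes _ _).symm, h2, mul_smul_comm,
      mul_one, norm_smul, Complex.norm_exp]
    calc _ ≤ Real.exp (((t : ℂ) * μ).re) * (C * Real.exp (-β * t)) := by
          gcongr; exact hC t ht
      _ = C * (Real.exp (t * μ) * Real.exp (-β * t)) := by
          rw [← Complex.ofReal_mul, Complex.ofReal_re]; ring
      _ = _ := by rw [← Real.exp_add]; ring_nf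
  obtain ⟨P, hP, hPs, hφ⟩ := exists_lyapunov_solution A (sub_pos.2 hμβ) hdecay
  have hsemi : P.PosSemidef := by
    refine Matrix.PosSemidef.of_dotProduct_mulVec_nonneg hPs fun x => ?_
    let φ : Matrix ι ι ℂ →ₗ[ℂ] ℂ :=
      { toFun := fun X => star x ⬝ᵥ (X *ᵥ x)
        map_add' := fun X Y => by rw [Matrix.add_mulVec, dotProduct_add]
        map_smul' := fun c X => by
          rw [Matrix.smul_mulVec, dotProduct_smul, RingHom.id_apply] }
    exact hφ (LinearMap.toContinuousLinearMap φ) fun X =>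
      (Matrix.posSemidef_conjTranspose_mul_self X).dotProduct_mulVec_nonneg x
  have hP' : -(Mᴴ * P + P * M) - (2 * μ : ℂ) • P = 1 := by
    have h1 : star A = Mᴴ + (μ : ℂ) • 1 := by
      simp [hA, Matrix.star_eq_conjTranspose]
    rw [h1, hA, add_mul, mul_add, smul_one_mul, mul_smul_one] at hP
    rw [← neg_eq_iff_eq_neg.2 hP]
    module
  refine ⟨P, Matrix.PosDef.of_dotProduct_mulVec_pos hPs fun x hx => ?_, hP' ▸ Matrix.PosDef.one⟩
  -- If the form vanishes at `x`, then `P x = 0`, so the Lyapunov equation tested at `x` gives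
  -- `-‖x‖² = 0`.
  refine lt_of_le_of_ne (hsemi.dotProduct_mulVec_nonneg x) fun h0 => hx ?_
  have hPx : P *ᵥ x = 0 := (hsemi.dotProduct_mulVec_zero_iff x).1 h0.symm
  have hxP : star x ᵥ* P = 0 := by
    have := congrArg star hPx
    rwa [Matrix.star_mulVec, ← Matrix.star_eq_conjTranspose, hPs, star_zero] at this
  have h1 : star x ⬝ᵥ ((star A * P + P * A) *ᵥ x) = 0 := by
    rw [Matrix.add_mulVec, dotProduct_add, ← Matrix.mulVec_mulVec, hPx, ← Matrix.mulVec_mulVec,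
      Matrix.dotProduct_mulVec (star x) P, hxP]
    simp
  rw [hP, Matrix.neg_mulVec, Matrix.one_mulVec, dotProduct_neg, neg_eq_zero] at h1
  exact dotProduct_star_self_eq_zero.1 h1

/-- Strictness survives the supremum because the spectrum is finite. -/
theorem spectralAbscissa_lt_iff {M : Matrix ι ι ℂ} {r : ℝ} :
    spectralAbscissa M < (r : EReal) ↔ ∀ z ∈ spectrum ℂ M, z.re < r := by
  constructor
  · intro h z hz
    exact EReal.coe_lt_coe_iff.1
      ((le_iSup₂ (f := fun (z : ℂ) (_ : z ∈ spectrum ℂ M) => ((z.re : ℝ) : EReal)) z hz).trans_lt h)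
  · intro h
    obtain ⟨β, hβ, hM⟩ := exists_gt_forall_re_lt (μ := -r) (by simpa using h)
    refine lt_of_le_of_lt (iSup₂_le fun z hz => EReal.coe_le_coe (hM z hz).le) ?_
    exact EReal.coe_lt_coe_iff.2 (by linarith)

theorem spectralAbscissa_le_iff {M : Matrix ι ι ℂ} {r : ℝ} :
    spectralAbscissa M ≤ (r : EReal) ↔ ∀ z ∈ spectrum ℂ M, z.re ≤ r := by
  simp [spectralAbscissa]

end ComplexMatrix

/-! ### Complex matrices as structured real matrices. -/

section Realification

variable {ι : Type*}

/-- The real matrix of a complex matrix acting on pairs of real and imaginary parts. -/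
def realify (X : Matrix ι ι ℂ) : Matrix (ι ⊕ ι) (ι ⊕ ι) ℝ :=
  Matrix.fromBlocks (X.map Complex.re) (-(X.map Complex.im)) (X.map Complex.im) (X.map Complex.re)

theorem realify_transpose (X : Matrix ι ι ℂ) : (realify X)ᵀ = realify Xᴴ := by
  ext (i | i) (j | j) <;> simp [realify]

theorem realify_add (X Y : Matrix ι ι ℂ) : realify (X + Y) = realify X + realify Y := by
  ext (i | i) (j | j) <;> simp [realify]; ring

theorem realify_neg (X : Matrix ι ι ℂ) : realify (-X) = -realify X := by
  ext (i | i) (j | j) <;> simp [realify]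

theorem realify_real_smul (r : ℝ) (X : Matrix ι ι ℂ) :
    realify ((r : ℂ) • X) = r • realify X := by
  ext (i | i) (j | j) <;> simp [realify]

theorem realify_complexMode {n m : ℕ} (A : Matrix (Fin n) (Fin n) ℝ)
    (B : Matrix (Fin n) (Fin m) ℝ) (K : Matrix (Fin m) (Fin n) ℝ) (z : ℂ) :
    realify (complexMode A B K z) = liftedMode A B K z := by
  ext (i | i) (j | j) <;> simp [realify, complexMode, liftedMode, toComplex]

variable [Fintype ι]

theorem realify_mul (X Y : Matrix ι ι ℂ) : realify (X * Y) = realify X * realify Y := by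
  rw [realify, realify, realify, Matrix.fromBlocks_multiply]
  congr 1 <;> ext i j <;>
    simp [Matrix.mul_apply, Finset.sum_add_distrib, Finset.sum_sub_distrib] <;> ring

/-- The real quadratic form at `(x, y)` is the real part of the Hermitian form of `X` at `x + i y`.
-/
theorem posDef_realify {X : Matrix ι ι ℂ} (hX : X.PosDef) : (realify X).PosDef := by
  refine Matrix.PosDef.of_dotProduct_mulVec_pos ?_ fun x hx => ?_
  · rw [Matrix.IsHermitian, Matrix.conjTranspose_eq_transpose_of_trivial, realify_transpose,
      hX.isHermitian]
  · set z : ι → ℂ := fun i => ⟨x (Sum.inl i), x (Sum.inr i)⟩ with hz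
    have hz0 : z ≠ 0 := by
      intro h0
      apply hx
      ext (i | i)
      · exact congrArg Complex.re (congrFun h0 i)
      · exact congrArg Complex.im (congrFun h0 i)
    have h1 := (Complex.pos_iff.1 (hX.dotProduct_mulVec_pos hz0)).1
    suffices h2 : star x ⬝ᵥ realify X *ᵥ x = (star z ⬝ᵥ X *ᵥ z).re from h2 ▸ h1
    simp only [dotProduct]
    rw [Fintype.sum_sum_type, ← Finset.sum_add_distrib, Complex.re_sum]
    refine Finset.sum_congr rfl fun i _ => ?_
    simp [hz, realify, Matrix.mulVec, dotProduct, Finset.sum_add_distrib, Finset.sum_sub_distrib]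
    ring

end Realification

/-! ### The complex, real and Lyapunov conditions. -/

section Conditions

variable {n m : ℕ} (A : Matrix (Fin n) (Fin n) ℝ) (B : Matrix (Fin n) (Fin m) ℝ)
  (K : Matrix (Fin m) (Fin n) ℝ)

/-- Realification preserves products, adjoints and positivity, so it carries the complex Lyapunov
inequality to the lifted one. A Hermitian matrix has symmetric real part and skew imaginary part,
which is the required structure. -/
theorem exists_structured_lyapunov {z : ℂ} {μ : ℝ}
    (h : ∀ s ∈ spectrum ℂ (complexMode A B K z), s.re < -μ) :
    ∃ P Q : Matrix (Fin n) (Fin n) ℝ, P.PosDef ∧ Qᵀ = -Q ∧ (liftedLyap P Q).PosDef ∧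
      LoewnerLT (He (liftedLyap P Q * liftedMode A B K z)) ((-2 * μ) • liftedLyap P Q) := by
  obtain ⟨P, hP, hL⟩ := exists_complex_lyapunov h
  have hPe : liftedLyap (P.map Complex.re) (P.map Complex.im) = realify P := rfl
  have hpos := posDef_realify hP
  refine ⟨P.map Complex.re, P.map Complex.im, ?_, ?_, hPe ▸ hpos, ?_⟩
  · exact hpos.submatrix (e := Sum.inl) Sum.inl_injective
  · ext i j
    simpa using (congrArg Complex.im (hP.isHermitian.apply j i)).symm
  · have h1 := posDef_realify hL
    rw [LoewnerLT, hPe, ← realify_complexMode, He, ← realify_mul, realify_transpose,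
      Matrix.conjTranspose_mul, hP.isHermitian]
    convert h1 using 1
    have h2 : (2 * μ : ℂ) = ((2 * μ : ℝ) : ℂ) := by push_cast; rfl
    rw [sub_eq_add_neg, sub_eq_add_neg, realify_add, realify_neg, realify_neg, realify_add, h2,
      realify_real_smul]
    module

/-- A strict Lyapunov inequality bounds the real parts of the eigenvalues. -/
theorem re_lt_of_lyapunov {ι : Type*} [Fintype ι] [DecidableEq ι] {P M : Matrix ι ι ℝ} {μ : ℝ}
    (hP : P.PosDef) (h : LoewnerLT (He (P * M)) ((-2 * μ) • P)) :
    ∀ s ∈ spectrum ℂ (toComplex M), s.re < -μ := by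
  intro s hs
  obtain ⟨v, hv0, hv⟩ := mem_spectrum_iff_exists_mulVec.1 hs
  set x : ι → ℝ := fun i => (v i).re with hx
  set y : ι → ℝ := fun i => (v i).im with hy
  have hMx : M *ᵥ x = s.re • x - s.im • y := by
    ext i
    have := congrArg Complex.re (congrFun hv i)
    simpa [Matrix.mulVec, dotProduct, toComplex] using this
  have hMy : M *ᵥ y = s.im • x + s.re • y := by
    ext i
    have := congrArg Complex.im (congrFun hv i)
    simp [Matrix.mulVec, dotProduct, toComplex] at this
    simp [Matrix.mulVec, dotProduct, hx, hy, this]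
    ring
  have hPt : Pᵀ = P := by
    have := hP.isHermitian
    rwa [Matrix.IsHermitian, Matrix.conjTranspose_eq_transpose_of_trivial] at this
  have hsymm : ∀ u w : ι → ℝ, u ⬝ᵥ (P *ᵥ w) = w ⬝ᵥ (P *ᵥ u) := by
    intro u w
    rw [Matrix.dotProduct_mulVec, dotProduct_comm, ← Matrix.mulVec_transpose, hPt]
  have hform : ∀ u : ι → ℝ, u ⬝ᵥ ((((-2 * μ) • P) - He (P * M)) *ᵥ u) =
      -2 * μ * (u ⬝ᵥ (P *ᵥ u)) - 2 * (u ⬝ᵥ (P *ᵥ (M *ᵥ u))) := by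
    intro u
    rw [He, Matrix.sub_mulVec, Matrix.add_mulVec, Matrix.smul_mulVec, dotProduct_sub,
      dotProduct_add, dotProduct_smul, Matrix.mulVec_transpose, dotProduct_comm u (u ᵥ* (P * M)),
      ← Matrix.dotProduct_mulVec, ← Matrix.mulVec_mulVec, smul_eq_mul]
    ring
  have hnn : ∀ u : ι → ℝ, 0 ≤ u ⬝ᵥ ((((-2 * μ) • P) - He (P * M)) *ᵥ u) := fun u => by
    simpa using h.posSemidef.dotProduct_mulVec_nonneg u
  have hpp : ∀ u : ι → ℝ, 0 ≤ u ⬝ᵥ (P *ᵥ u) := fun u => by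
    simpa using hP.posSemidef.dotProduct_mulVec_nonneg u
  have hpos : ∀ u : ι → ℝ, u ≠ 0 → 0 < u ⬝ᵥ ((((-2 * μ) • P) - He (P * M)) *ᵥ u) := fun u hu => by
    simpa using h.dotProduct_mulVec_pos hu
  have hsum : 0 < x ⬝ᵥ ((((-2 * μ) • P) - He (P * M)) *ᵥ x) +
      y ⬝ᵥ ((((-2 * μ) • P) - He (P * M)) *ᵥ y) := by
    by_cases hx0 : x = 0
    · have hy0 : y ≠ 0 := fun hy0 => hv0 <| by
        ext i
        exact Complex.ext (congrFun hx0 i) (congrFun hy0 i)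
      exact add_pos_of_nonneg_of_pos (hnn x) (hpos y hy0)
    · exact add_pos_of_pos_of_nonneg (hpos x hx0) (hnn y)
  -- For the eigenvector `x + i y`, the cross terms carrying `s.im` cancel by symmetry of `P`,
  -- leaving `-2 (μ + s.re) (xᵀ P x + yᵀ P y) > 0`.
  rw [hform, hform, hMx, hMy, Matrix.mulVec_sub, Matrix.mulVec_add, dotProduct_sub,
    dotProduct_add] at hsum
  simp only [Matrix.mulVec_smul, dotProduct_smul, smul_eq_mul] at hsum
  rw [hsymm y x] at hsum
  have h1 := hpp x
  have h2 := hpp y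
  by_contra hcon
  push Not at hcon
  nlinarith

/-- On vectors `(w, -i w)` the lifted matrix acts as the complex mode acts on `w`. -/
theorem mem_spectrum_liftedMode {z s : ℂ} (hs : s ∈ spectrum ℂ (complexMode A B K z)) :
    s ∈ spectrum ℂ (toComplex (liftedMode A B K z)) := by
  obtain ⟨w, hw0, hw⟩ := mem_spectrum_iff_exists_mulVec.1 hs
  refine mem_spectrum_iff_exists_mulVec.2 ⟨Sum.elim w (-Complex.I • w), fun h0 => hw0 ?_, ?_⟩
  · ext i
    exact congrFun h0 (Sum.inl i)
  · have hre : ∀ r : ℝ, toComplex (A - r • (B * K)) = toComplex A - (r : ℂ) • toComplex (B * K) := by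
      intro r; ext i j; simp [toComplex]
    have him : ∀ r : ℝ, toComplex (r • (B * K)) = (r : ℂ) • toComplex (B * K) := by
      intro r; ext i j; simp [toComplex]
    have hneg : ∀ X : Matrix (Fin n) (Fin n) ℝ, toComplex (-X) = -toComplex X := by
      intro X; ext i j; simp [toComplex]
    have hblock : toComplex (liftedMode A B K z) =
        Matrix.fromBlocks (toComplex A - (z.re : ℂ) • toComplex (B * K))
          ((z.im : ℂ) • toComplex (B * K)) (-((z.im : ℂ) • toComplex (B * K)))
          (toComplex A - (z.re : ℂ) • toComplex (B * K)) := by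
      rw [← hre, ← him, ← hneg]
      exact Matrix.fromBlocks_map _ _ _ _ _
    have hz : complexMode A B K z *ᵥ w = toComplex A *ᵥ w -
        (z.re + z.im * Complex.I) • (toComplex (B * K) *ᵥ w) := by
      rw [complexMode, Matrix.sub_mulVec, Matrix.smul_mulVec, Complex.re_add_im]
    rw [hz] at hw
    rw [hblock, Matrix.fromBlocks_mulVec]
    ext (i | i)
    · have := congrFun hw i
      simp [Matrix.sub_mulVec, Matrix.smul_mulVec, Matrix.mulVec_smul, Matrix.mulVec_neg] at this ⊢
      linear_combination this - (toComplex (B * K) *ᵥ w) i * Complex.re_add_im z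
    · have := congrFun hw i
      simp [Matrix.sub_mulVec, Matrix.neg_mulVec, Matrix.smul_mulVec, Matrix.mulVec_smul,
        Matrix.mulVec_neg] at this ⊢
      rw [mul_left_comm, ← this]
      linear_combination (-z.im * (toComplex (B * K) *ᵥ w) i) * Complex.I_sq +
        (toComplex (B * K) *ᵥ w) i * Complex.I * Complex.re_add_im z

/-- `A` and `BK` are real, so conjugating an eigenvector suffices. This is why one eigenvalue per
conjugate pair is enough. -/
theorem conj_mem_spectrum_complexMode {z s : ℂ}
    (hs : s ∈ spectrum ℂ (complexMode A B K (starRingEnd ℂ z))) :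
    starRingEnd ℂ s ∈ spectrum ℂ (complexMode A B K z) := by
  obtain ⟨w, hw0, hw⟩ := mem_spectrum_iff_exists_mulVec.1 hs
  refine mem_spectrum_iff_exists_mulVec.2 ⟨star w, by simpa using hw0, ?_⟩
  ext i
  have := congrArg (starRingEnd ℂ) (congrFun hw i)
  simpa [Matrix.mulVec, dotProduct, complexMode, toComplex] using this

variable {A B K} {ν : ℕ} {lam : Fin ν → ℂ} {μ : ℝ}

theorem ComplexCondition.lyapunovCondition (h : ComplexCondition A B K lam μ) :
    LyapunovCondition A B K lam μ := fun k =>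
  exists_structured_lyapunov A B K (spectralAbscissa_lt_iff.1 (h k))

theorem LyapunovCondition.realCondition (h : LyapunovCondition A B K lam μ) :
    RealCondition A B K lam μ := fun k => by
  obtain ⟨P, Q, -, -, hP, hL⟩ := h k
  exact spectralAbscissa_lt_iff.2 (re_lt_of_lyapunov hP hL)

theorem RealCondition.complexCondition (h : RealCondition A B K lam μ) :
    ComplexCondition A B K lam μ := fun k =>
  spectralAbscissa_lt_iff.2 fun s hs =>
    spectralAbscissa_lt_iff.1 (h k) s (mem_spectrum_liftedMode A B K hs)

end Conditions

/-! ### Laplacian spectrum and the maximum principle. -/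

section Laplacian

variable {N : ℕ} {W : Matrix (Fin N) (Fin N) ℝ}

theorem laplacian_mulVec_apply (v : Fin N → ℝ) (i : Fin N) :
    (laplacian W *ᵥ v) i = ∑ j, W i j * (v i - v j) := by
  rw [laplacian, Matrix.sub_mulVec, Pi.sub_apply, Matrix.mulVec_diagonal]
  simp [Matrix.mulVec, dotProduct, mul_sub, Finset.sum_mul]

theorem laplacian_row_sum (i : Fin N) : ∑ j, laplacian W i j = 0 := by
  have h := laplacian_mulVec_apply (W := W) (fun _ => 1) i
  simpa [Matrix.mulVec, dotProduct] using h

/-- At a maximizer of `v` every term `W i j * (v i - v j)` is nonnegative. -/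
theorem nonneg_of_laplacian_mulVec_eq_const (hW : ∀ i j, 0 ≤ W i j) (r : Fin N) {v : Fin N → ℝ}
    {c : ℝ} (h : ∀ i, (laplacian W *ᵥ v) i = c) : 0 ≤ c := by
  obtain ⟨i, -, hi⟩ := Finset.exists_max_image Finset.univ v ⟨r, Finset.mem_univ r⟩
  rw [← h i, laplacian_mulVec_apply]
  exact Finset.sum_nonneg fun j hj => mul_nonneg (hW i j) (sub_nonneg.2 (hi j hj))

/-- Maximum principle: a function annihilated by the Laplacian attains its maximum at every
root. -/
theorem le_root_of_laplacian_mulVec_eq_zero (hW : ∀ i j, 0 ≤ W i j) {r : Fin N}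
    (hr : ∀ i, Relation.ReflTransGen (fun j i : Fin N => 0 < W i j) r i) {v : Fin N → ℝ}
    (h : ∀ i, (laplacian W *ᵥ v) i = 0) (i : Fin N) : v i ≤ v r := by
  obtain ⟨k, -, hk⟩ := Finset.exists_max_image Finset.univ v ⟨r, Finset.mem_univ r⟩
  suffices hrk : v r = v k from hrk ▸ hk i (Finset.mem_univ i)
  -- Walk back from the maximizer `k` to the root: at a maximal node the vanishing sum has
  -- nonnegative terms, so its in-neighbours are maximal too.
  refine Relation.ReflTransGen.head_induction_on (motive := fun a _ => v a = v k) (hr k) rfl ?_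
  intro a b hab _ hb
  have h1 := h b
  rw [laplacian_mulVec_apply, Finset.sum_eq_zero_iff_of_nonneg fun j hj =>
    mul_nonneg (hW b j) (sub_nonneg.2 (hb ▸ hk j hj))] at h1
  have h2 := (mul_eq_zero.1 (h1 a (Finset.mem_univ a))).resolve_left hab.ne'
  linarith

/-- The sign lemma for `v` and `-v` forces `c = 0`; the maximum principle for both then pins `v` to
its root value. -/
theorem eq_root_of_laplacian_mulVec_eq_const (hW : ∀ i j, 0 ≤ W i j) {r : Fin N}
    (hr : ∀ i, Relation.ReflTransGen (fun j i : Fin N => 0 < W i j) r i) {v : Fin N → ℝ} {c : ℝ}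
    (h : ∀ i, (laplacian W *ᵥ v) i = c) (i : Fin N) : v i = v r := by
  have hneg : ∀ i, (laplacian W *ᵥ (-v)) i = -c := fun i => by
    rw [Matrix.mulVec_neg, Pi.neg_apply, h]
  have h1 := nonneg_of_laplacian_mulVec_eq_const hW r h
  have h2 := nonneg_of_laplacian_mulVec_eq_const hW r hneg
  obtain rfl : c = 0 := by linarith
  have h3 := le_root_of_laplacian_mulVec_eq_zero hW hr h i
  have h4 := le_root_of_laplacian_mulVec_eq_zero hW hr (fun i => by rw [hneg, neg_zero]) i
  simp only [Pi.neg_apply] at h4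
  linarith

theorem eq_root_of_complex_laplacian_mulVec_eq_const (hW : ∀ i j, 0 ≤ W i j) {r : Fin N}
    (hr : ∀ i, Relation.ReflTransGen (fun j i : Fin N => 0 < W i j) r i) {v : Fin N → ℂ} {c : ℂ}
    (h : ∀ i, (toComplex (laplacian W) *ᵥ v) i = c) (i : Fin N) : v i = v r := by
  apply Complex.ext
  · refine eq_root_of_laplacian_mulVec_eq_const hW hr (v := fun i => (v i).re) (c := c.re)
      (fun i => ?_) i
    simpa [Matrix.mulVec, dotProduct, toComplex] using congrArg Complex.re (h i)
  · refine eq_root_of_laplacian_mulVec_eq_const hW hr (v := fun i => (v i).im) (c := c.im)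
      (fun i => ?_) i
    simpa [Matrix.mulVec, dotProduct, toComplex] using congrArg Complex.im (h i)

theorem toComplex_laplacian_mulVec_const (c : ℂ) (i : Fin N) :
    (toComplex (laplacian W) *ᵥ fun _ => c) i = 0 := by
  have h := congrArg Complex.ofReal (laplacian_row_sum (W := W) i)
  simp only [Complex.ofReal_sum, Complex.ofReal_zero] at h
  simp [Matrix.mulVec, dotProduct, toComplex, ← Finset.sum_mul, h]

/-- The Laplacian acting on the differences to the state of the agent `r`. -/
def reducedLaplacian (W : Matrix (Fin N) (Fin N) ℝ) (r : Fin N) :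
    Matrix {i // i ≠ r} {i // i ≠ r} ℝ :=
  Matrix.of fun i j => laplacian W i j - laplacian W r j

theorem spectrum_reducedLaplacian (hW : ∀ i j, 0 ≤ W i j) {r : Fin N}
    (hr : ∀ i, Relation.ReflTransGen (fun j i : Fin N => 0 < W i j) r i) {z : ℂ}
    (hz : z ∈ spectrum ℂ (toComplex (reducedLaplacian W r))) :
    z ≠ 0 ∧ z ∈ spectrum ℂ (toComplex (laplacian W)) := by
  obtain ⟨v, hv0, hv⟩ := mem_spectrum_iff_exists_mulVec.1 hz
  -- Extended by zero at `r`, the eigenvector satisfies `L u = z u + c 1`. If `z = 0`, then `u` is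
  -- constant, hence zero; otherwise the shift by `c / z` makes it an eigenvector of `L`, which
  -- annihilates constants.
  set u : Fin N → ℂ := fun i => if h : i ≠ r then v ⟨i, h⟩ else 0 with hu
  have hur : u r = 0 := by simp [hu]
  have huv : ∀ i : {i // i ≠ r}, u i = v i := fun i => by simp [hu, i.2]
  set c := (toComplex (laplacian W) *ᵥ u) r with hc
  have hsum : ∀ i, (toComplex (laplacian W) *ᵥ u) i =
      ∑ j : {j // j ≠ r}, (laplacian W i j : ℂ) * v j := fun i => by
    rw [Matrix.mulVec, dotProduct, Fintype.sum_eq_add_sum_subtype_ne _ r, hur, mul_zero, zero_add]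
    exact Finset.sum_congr rfl fun j _ => by rw [huv]; rfl
  have hLu : ∀ i, (toComplex (laplacian W) *ᵥ u) i = z * u i + c := by
    intro i
    by_cases hi : i = r
    · rw [hi, hur, mul_zero, zero_add]
    · have h1 := congrFun hv ⟨i, hi⟩
      rw [hc, hsum, hsum, huv ⟨i, hi⟩, ← sub_eq_iff_eq_add, ← smul_eq_mul z, ← Pi.smul_apply, ← h1,
        ← Finset.sum_sub_distrib]
      exact Finset.sum_congr rfl fun j _ => by
        simp [toComplex, reducedLaplacian, sub_mul]
  have hu0 : ∀ b : ℂ, (∀ i, u i + b = u r + b) → False := by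
    intro b hb
    apply hv0
    ext i
    have := hb i
    rw [add_left_inj, hur, huv] at this
    exact this
  have hz0 : z ≠ 0 := by
    rintro rfl
    refine hu0 0 fun i => ?_
    rw [eq_root_of_complex_laplacian_mulVec_eq_const hW hr (v := u) (c := c)
      (fun i => by rw [hLu]; ring) i]
  refine ⟨hz0, mem_spectrum_iff_exists_mulVec.2 ⟨fun i => u i + c / z, fun h0 => ?_, ?_⟩⟩
  · exact hu0 (c / z) fun i => (congrFun h0 i).trans (congrFun h0 r).symm
  · ext i
    have h1 : (fun i => u i + c / z) = u + fun _ => c / z := rfl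
    rw [h1, Matrix.mulVec_add, Pi.add_apply, hLu, toComplex_laplacian_mulVec_const]
    simp only [Pi.smul_apply, Pi.add_apply, smul_eq_mul]
    field_simp
    ring

end Laplacian

/-! ### Modal decomposition of Kronecker matrices. -/

section Kronecker

variable {ι κ : Type*} [Fintype ι] [Fintype κ]

theorem kronecker_mulVec_apply (G : Matrix ι ι ℂ) (F : Matrix κ κ ℂ) (v : ι × κ → ℂ) (i : ι)
    (a : κ) : ((G ⊗ₖ F) *ᵥ v) (i, a) = ∑ j, G i j * (F *ᵥ fun b => v (j, b)) a := by
  simp [Matrix.mulVec, dotProduct, Fintype.sum_prod_type, Finset.mul_sum, mul_assoc]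

variable [DecidableEq ι] [DecidableEq κ]

/-- The eigenvalues of `1 ⊗ A - G ⊗ F` are eigenvalues of the modes `A - z F`, for the eigenvalues
`z` of `G`. -/
theorem exists_mode_of_mem_spectrum {G : Matrix ι ι ℂ} {A F : Matrix κ κ ℂ} {s : ℂ}
    (hs : s ∈ spectrum ℂ ((1 : Matrix ι ι ℂ) ⊗ₖ A - G ⊗ₖ F)) :
    ∃ z ∈ spectrum ℂ G, s ∈ spectrum ℂ (A - z • F) := by
  have hcomm : Commute ((1 : Matrix ι ι ℂ) ⊗ₖ A - G ⊗ₖ F) (G ⊗ₖ (1 : Matrix κ κ ℂ)) := by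
    refine Commute.sub_left ?_ ?_ <;>
      simp [Commute, SemiconjBy, ← Matrix.mul_kronecker_mul]
  obtain ⟨z, v, hv0, hv, hz⟩ := exists_common_eigenvector hcomm hs
  -- A nonzero entry keeps both slices through it nonzero: `v (·, a)` is an eigenvector of `G`, and
  -- `v (i, ·)` one of `A - z F`.
  obtain ⟨⟨i, a⟩, hia⟩ := Function.ne_iff.1 hv0
  have hG : ∀ j b, ∑ k, G j k * v (k, b) = z * v (j, b) := fun j b => by
    have := congrFun hz (j, b)
    rw [kronecker_mulVec_apply] at this
    simpa using this
  refine ⟨z, mem_spectrum_iff_exists_mulVec.2 ⟨fun j => v (j, a), fun h0 => hia (congrFun h0 i), ?_⟩,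
    mem_spectrum_iff_exists_mulVec.2 ⟨fun b => v (i, b), fun h0 => hia (congrFun h0 a), ?_⟩⟩
  · ext j
    exact hG j a
  · ext b
    have h1 := congrFun hv (i, b)
    rw [Matrix.sub_mulVec, Pi.sub_apply, kronecker_mulVec_apply, kronecker_mulVec_apply] at h1
    have h2 : ∑ j, G i j * (F *ᵥ fun b => v (j, b)) b = z * (F *ᵥ fun b => v (i, b)) b := by
      simp only [Matrix.mulVec, dotProduct, Finset.mul_sum]
      rw [Finset.sum_comm]
      refine Finset.sum_congr rfl fun c _ => ?_
      rw [mul_left_comm, ← hG, Finset.mul_sum]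
      exact Finset.sum_congr rfl fun j _ => by ring
    rw [h2] at h1
    simpa [Matrix.sub_mulVec, Matrix.smul_mulVec, Matrix.one_apply] using h1

end Kronecker

/-! ### Linear differential equations and the matrix exponential. -/

section LinearODE

variable {ι : Type*} [Fintype ι]

theorem euclidean_norm_le_sum {𝕜 : Type*} [RCLike 𝕜] (x : EuclideanSpace 𝕜 ι) :
    ‖x‖ ≤ ∑ i, ‖x i‖ := by
  rw [EuclideanSpace.norm_eq]
  exact Real.sqrt_le_iff.2 ⟨Finset.sum_nonneg fun i _ => norm_nonneg _,
    Finset.sum_sq_le_sq_sum_of_nonneg fun i _ => norm_nonneg _⟩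

variable [DecidableEq ι]

theorem hasDerivAt_clm_exp_smul {𝔸 : Type*} [NormedRing 𝔸] [NormedAlgebra ℂ 𝔸] [CompleteSpace 𝔸]
    (a : 𝔸) (φ : 𝔸 →L[ℂ] ℂ) (t : ℝ) :
    HasDerivAt (fun u : ℝ => φ (NormedSpace.exp ((u : ℂ) • a)))
      (φ (a * NormedSpace.exp ((t : ℂ) • a))) t :=
  (φ.hasFDerivAt.comp_hasDerivAt (t : ℂ) (hasDerivAt_exp_smul_const' a (t : ℂ))).comp_ofReal

open scoped Matrix.Norms.L2Operator in
theorem hasDerivAt_exp_smul_mulVec (M : Matrix ι ι ℂ) (v : ι → ℂ) (t : ℝ) :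
    HasDerivAt (fun u : ℝ => NormedSpace.exp ((u : ℂ) • M) *ᵥ v)
      (M *ᵥ (NormedSpace.exp ((t : ℂ) • M) *ᵥ v)) t := by
  rw [hasDerivAt_pi]
  intro i
  let φ : Matrix ι ι ℂ →ₗ[ℂ] ℂ :=
    { toFun := fun X => (X *ᵥ v) i
      map_add' := fun X Y => by rw [Matrix.add_mulVec, Pi.add_apply]
      map_smul' := fun c X => by rw [Matrix.smul_mulVec, Pi.smul_apply, RingHom.id_apply] }
  rw [Matrix.mulVec_mulVec]
  exact hasDerivAt_clm_exp_smul M (LinearMap.toContinuousLinearMap φ) t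

/-- The solution of a linear differential equation on the half line is given by the matrix
exponential. -/
theorem eq_exp_smul_mulVec {M : Matrix ι ι ℂ} {y : ℝ → ι → ℂ}
    (hy : ∀ t, 0 ≤ t → HasDerivWithinAt y (M *ᵥ y t) (Set.Ici 0) t) {t : ℝ} (ht : 0 ≤ t) :
    y t = NormedSpace.exp ((t : ℂ) • M) *ᵥ y 0 := by
  let T : (ι → ℂ) →L[ℂ] (ι → ℂ) := LinearMap.toContinuousLinearMap (Matrix.mulVecLin M)
  refine ODE_solution_unique (f := y) (v := fun _ x => M *ᵥ x) (K := ‖T‖₊)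
    (g := fun u => NormedSpace.exp ((u : ℂ) • M) *ᵥ y 0) (a := 0) (b := t)
    (fun _ => T.lipschitz) ?_ ?_ ?_ ?_ ?_ (Set.right_mem_Icc.2 ht)
  · exact fun s hs => (hy s hs.1).continuousWithinAt.mono fun u hu => hu.1
  · exact fun s hs => (hy s hs.1).mono (Set.Ici_subset_Ici.2 hs.1)
  · exact fun s _ => (hasDerivAt_exp_smul_mulVec M (y 0) s).continuousAt.continuousWithinAt
  · exact fun s _ => (hasDerivAt_exp_smul_mulVec M (y 0) s).hasDerivWithinAt
  · simp

open scoped Matrix.Norms.L2Operator in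
theorem norm_mulVec_apply_le (M : Matrix ι ι ℂ) (v : ι → ℂ) (i : ι) :
    ‖(M *ᵥ v) i‖ ≤ ‖M‖ * ∑ j, ‖v j‖ := by
  have h1 := Matrix.l2_opNorm_mulVec M (WithLp.toLp 2 v)
  have h2 := PiLp.norm_apply_le ((EuclideanSpace.equiv ι ℂ).symm (M *ᵥ v)) i
  have h3 := euclidean_norm_le_sum (𝕜 := ℂ) (WithLp.toLp 2 v)
  exact h2.trans (h1.trans (mul_le_mul_of_nonneg_left h3 (norm_nonneg M)))

end LinearODE

/-! ### Error dynamics and exponential synchronization. -/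

section Network

variable {N n m : ℕ} {A : Matrix (Fin n) (Fin n) ℝ} {B : Matrix (Fin n) (Fin m) ℝ}
  {K : Matrix (Fin m) (Fin n) ℝ} {W : Matrix (Fin N) (Fin N) ℝ}

theorem mulVec_diffusiveInput (x : State N n) (i : Fin N) (a : Fin n) :
    (B *ᵥ fun c => diffusiveInput W K x (i, c)) a =
      -∑ j, laplacian W i j * ((B * K) *ᵥ fun b => x (j, b)) a := by
  have h1 : ∀ c, diffusiveInput W K x (i, c) =
      -∑ j, laplacian W i j * (K *ᵥ fun b => x (j, b)) c := fun c => by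
    simp [diffusiveInput, Matrix.mulVec, dotProduct, Fintype.sum_prod_type, Finset.mul_sum,
      mul_assoc]
  have h2 : (fun c => diffusiveInput W K x (i, c)) =
      -∑ j, laplacian W i j • (K *ᵥ fun b => x (j, b)) := by
    ext c
    simp [h1]
  rw [h2, Matrix.mulVec_neg, Matrix.mulVec_sum]
  simp [Matrix.mulVec_smul, Matrix.mulVec_mulVec]

/-- A synchronized state cancels in the difference of two agents, so each agent contributes at most
the distance to it; hence the factor 2. -/
theorem abs_sub_le_infDist (x : State N n) (i j : Fin N) (a : Fin n) :
    |x (i, a) - x (j, a)| ≤ 2 * Metric.infDist x (syncSet N n) := by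
  have hne : (syncSet N n).Nonempty := ⟨0, fun i j a => by simp⟩
  suffices h : |x (i, a) - x (j, a)| / 2 ≤ Metric.infDist x (syncSet N n) by linarith
  refine (Metric.le_infDist hne).2 fun y hy => ?_
  have h1 := PiLp.norm_apply_le (x - y) (i, a)
  have h2 := PiLp.norm_apply_le (x - y) (j, a)
  have h3 := hy i j a
  rw [dist_eq_norm]
  simp only [PiLp.sub_apply, Real.norm_eq_abs] at h1 h2
  have h4 : x (i, a) - x (j, a) = (x (i, a) - y (i, a)) - (x (j, a) - y (j, a)) := by linarith
  rw [h4]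
  linarith [abs_sub (x (i, a) - y (i, a)) (x (j, a) - y (j, a))]

/-- Compare `x` with the synchronized state in which all agents copy agent `r`. -/
theorem infDist_syncSet_le_sum (x : State N n) (r : Fin N) :
    Metric.infDist x (syncSet N n) ≤
      ∑ p : {i // i ≠ r} × Fin n, |x (p.1, p.2) - x (r, p.2)| := by
  have hmem : (WithLp.toLp 2 fun p : Fin N × Fin n => x (r, p.2)) ∈ syncSet N n :=
    fun i j a => sub_self _
  refine (Metric.infDist_le_dist_of_mem hmem).trans ?_
  rw [dist_eq_norm]
  refine (euclidean_norm_le_sum _).trans (le_of_eq ?_)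
  rw [Fintype.sum_prod_type, Fintype.sum_prod_type, Fintype.sum_eq_add_sum_subtype_ne _ r]
  simp

/-- The matrix governing the differences to the state of the agent `r`. -/
noncomputable def reducedNetwork (A : Matrix (Fin n) (Fin n) ℝ) (B : Matrix (Fin n) (Fin m) ℝ)
    (K : Matrix (Fin m) (Fin n) ℝ) (W : Matrix (Fin N) (Fin N) ℝ) (r : Fin N) :
    Matrix ({i // i ≠ r} × Fin n) ({i // i ≠ r} × Fin n) ℂ :=
  (1 : Matrix {i // i ≠ r} {i // i ≠ r} ℂ) ⊗ₖ toComplex A -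
    toComplex (reducedLaplacian W r) ⊗ₖ toComplex (B * K)

theorem toComplex_mulVec_ofReal {ι κ : Type*} [Fintype κ] (M : Matrix ι κ ℝ) (v : κ → ℝ) (i : ι) :
    (toComplex M *ᵥ fun j => (v j : ℂ)) i = ((M *ᵥ v) i : ℂ) := by
  simp [Matrix.mulVec, dotProduct, toComplex]

/-- Zero row sums of `L` allow every `x_j` in the coupling to be replaced by `x_j - x_r`; the term
`j = r` then drops out and the system closes. -/
theorem IsTrajectory.hasDerivWithinAt_sub {x : ℝ → State N n} (hx : IsTrajectory A B K W x)
    (r : Fin N) {t : ℝ} (ht : 0 ≤ t) :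
    HasDerivWithinAt (fun s (p : {i // i ≠ r} × Fin n) => ((x s (p.1, p.2) - x s (r, p.2) : ℝ) : ℂ))
      (reducedNetwork A B K W r *ᵥ
        fun p : {i // i ≠ r} × Fin n => ((x t (p.1, p.2) - x t (r, p.2) : ℝ) : ℂ))
      (Set.Ici 0) t := by
  rw [hasDerivWithinAt_pi]
  rintro ⟨i, a⟩
  have h1 := ((hx t ht i a).sub (hx t ht r a)).ofReal_comp
  refine h1.congr_deriv ?_
  rw [reducedNetwork, Matrix.sub_mulVec, Pi.sub_apply, kronecker_mulVec_apply,
    kronecker_mulVec_apply]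
  simp only [toComplex_mulVec_ofReal, mulVec_diffusiveInput]
  have h2 : ∀ (M : Matrix (Fin n) (Fin n) ℝ) (j : Fin N),
      (M *ᵥ fun b => x t (j, b) - x t (r, b)) a =
        (M *ᵥ fun b => x t (j, b)) a - (M *ᵥ fun b => x t (r, b)) a := fun M j => by
    rw [← Pi.sub_apply, ← Matrix.mulVec_sub]
    rfl
  have h3 : ∑ j : {j // j ≠ r}, reducedLaplacian W r i j *
      ((B * K) *ᵥ fun b => x t (j, b) - x t (r, b)) a =
      ∑ j, (laplacian W i j - laplacian W r j) *
        (((B * K) *ᵥ fun b => x t (j, b)) a - ((B * K) *ᵥ fun b => x t (r, b)) a) := by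
    rw [Fintype.sum_eq_add_sum_subtype_ne _ r, sub_self, mul_zero, zero_add]
    exact Finset.sum_congr rfl fun j _ => by rw [h2]; rfl
  have h4 : ∑ j, (toComplex (reducedLaplacian W r) i j) *
      (((B * K) *ᵥ fun b => x t (j, b) - x t (r, b)) a : ℂ) =
      ((∑ j : {j // j ≠ r}, reducedLaplacian W r i j *
      ((B * K) *ᵥ fun b => x t (j, b) - x t (r, b)) a : ℝ) : ℂ) := by
    simp [toComplex]
  rw [h4, h3]
  simp only [Matrix.one_apply, ite_mul, one_mul, zero_mul, Finset.sum_ite_eq, Finset.mem_univ,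
    if_true, h2]
  rw [← Complex.ofReal_sub, Complex.ofReal_inj]
  simp only [mul_sub, Finset.sum_sub_distrib, sub_mul, ← Finset.sum_mul, laplacian_row_sum]
  ring

/-- Sufficiency: if the modes of all nonzero Laplacian eigenvalues decay faster than `μ`, then the
synchronization set is exponentially stable with a rate larger than `μ`. -/
theorem exists_isUGES (hW : ∀ i j, 0 ≤ W i j) (hconn : HasSpanningTree W) {μ : ℝ}
    (h : ∀ z ∈ spectrum ℂ (toComplex (laplacian W)), z ≠ 0 →
      ∀ s ∈ spectrum ℂ (complexMode A B K z), s.re < -μ) :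
    ∃ μ', μ < μ' ∧ IsUGES A B K W μ' := by
  obtain ⟨r, hr⟩ := hconn
  have hspec : ∀ s ∈ spectrum ℂ (reducedNetwork A B K W r), s.re < -μ := by
    intro s hs
    obtain ⟨z, hz, hsz⟩ := exists_mode_of_mem_spectrum hs
    obtain ⟨hz0, hzL⟩ := spectrum_reducedLaplacian hW hr hz
    exact h z hzL hz0 s hsz
  obtain ⟨β, hμβ, hβ⟩ := exists_gt_forall_re_lt hspec
  obtain ⟨C, hC0, hC⟩ := exists_norm_matrix_exp_le hβ
  set k : ℝ := ((Fintype.card ({i // i ≠ r} × Fin n) : ℕ) : ℝ) with hk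
  have hk0 : 0 ≤ k := Nat.cast_nonneg _
  -- Each `k` counts the components in a sum and the 2 comes from `abs_sub_le_infDist`; the `+ 1`
  -- keeps the constant positive when `k = 0`.
  refine ⟨β, hμβ, k * (C * (k * 2)) + 1, by positivity, fun x hx t ht => ?_⟩
  set D := Metric.infDist (x 0) (syncSet N n)
  have hD : 0 ≤ D := Metric.infDist_nonneg
  have hsol := eq_exp_smul_mulVec (fun t ht => hx.hasDerivWithinAt_sub r ht) ht
  have h0 : ∑ p : {i // i ≠ r} × Fin n, ‖((x 0 (p.1, p.2) - x 0 (r, p.2) : ℝ) : ℂ)‖ ≤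
      k * (2 * D) := by
    rw [hk, ← nsmul_eq_mul]
    refine Finset.sum_le_card_nsmul _ _ _ fun p _ => ?_
    rw [Complex.norm_real]
    exact abs_sub_le_infDist _ _ _ _
  have ht' : ∀ p : {i // i ≠ r} × Fin n, |x t (p.1, p.2) - x t (r, p.2)| ≤
      C * Real.exp (-β * t) * (k * (2 * D)) := by
    intro p
    have h1 := norm_mulVec_apply_le (NormedSpace.exp ((t : ℂ) • reducedNetwork A B K W r))
      (fun p : {i // i ≠ r} × Fin n => ((x 0 (p.1, p.2) - x 0 (r, p.2) : ℝ) : ℂ)) p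
    rw [← congrFun hsol p, Complex.norm_real] at h1
    refine h1.trans (mul_le_mul (hC t ht) h0 ?_ (by positivity))
    exact Finset.sum_nonneg fun _ _ => norm_nonneg _
  calc Metric.infDist (x t) (syncSet N n)
      ≤ ∑ p : {i // i ≠ r} × Fin n, |x t (p.1, p.2) - x t (r, p.2)| := infDist_syncSet_le_sum _ _
    _ ≤ k * (C * Real.exp (-β * t) * (k * (2 * D))) := by
      rw [hk, ← nsmul_eq_mul]
      exact Finset.sum_le_card_nsmul _ _ _ fun p _ => ht' p
    _ = k * (C * (k * 2)) * Real.exp (-β * t) * D := by ring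
    _ ≤ (k * (C * (k * 2)) + 1) * Real.exp (-β * t) * D := by gcongr; linarith

/-- A Laplacian eigenvector `v` and an eigenvector `w` of the corresponding mode give the
trajectories `Re (c exp (s t) v ⊗ w)`. -/
theorem isTrajectory_mode {z s c : ℂ} {v : Fin N → ℂ} {w : Fin n → ℂ}
    (hv : toComplex (laplacian W) *ᵥ v = z • v) (hw : complexMode A B K z *ᵥ w = s • w) :
    IsTrajectory A B K W fun t =>
      WithLp.toLp 2 fun p : Fin N × Fin n => (c * Complex.exp (s * t) * (v p.1 * w p.2)).re := by
  intro t _ i a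
  have hexp : HasDerivAt (fun u : ℂ => c * Complex.exp (s * u) * (v i * w a))
      (c * (Complex.exp (s * t) * s) * (v i * w a)) (t : ℂ) := by
    have h1 : HasDerivAt (fun u : ℂ => s * u) s (t : ℂ) := by
      simpa using (hasDerivAt_id (t : ℂ)).const_mul s
    exact ((h1.cexp).const_mul c).mul_const _
  refine (hexp.real_of_complex.hasDerivWithinAt).congr_deriv ?_
  have hre : ∀ (M : Matrix (Fin n) (Fin n) ℝ) (d : ℂ),
      (M *ᵥ fun b => (d * w b).re) a = (d * (toComplex M *ᵥ w) a).re := fun M d => by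
    simp only [Matrix.mulVec, dotProduct, toComplex, Finset.mul_sum, Complex.re_sum,
      Matrix.map_apply]
    refine Finset.sum_congr rfl fun b _ => ?_
    rw [mul_left_comm, Complex.re_ofReal_mul]
  have hL : ∑ j, (laplacian W i j : ℂ) * v j = z * v i := congrFun hv i
  have hm : (toComplex A *ᵥ w) a - z * (toComplex (B * K) *ᵥ w) a = s * w a := by
    have := congrFun hw a
    rwa [complexMode, Matrix.sub_mulVec, Matrix.smul_mulVec] at this
  rw [mulVec_diffusiveInput]
  simp only [← mul_assoc _ (v _) (w _), hre]
  have h2 : ∀ j, laplacian W i j *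
      (c * Complex.exp (s * t) * v j * (toComplex (B * K) *ᵥ w) a).re =
      (c * Complex.exp (s * t) * (toComplex (B * K) *ᵥ w) a * (laplacian W i j * v j)).re :=
    fun j => by rw [← Complex.re_ofReal_mul]; ring_nf
  simp only [h2]
  rw [← Complex.re_sum, ← Finset.mul_sum, hL, ← Complex.neg_re, ← Complex.add_re]
  congr 1
  linear_combination (-c * Complex.exp (s * t) * v i) * hm

/-- Necessity: an exponential rate of the synchronization set bounds the real parts of the
eigenvalues of all modes. -/
theorem IsUGES.re_le {μ : ℝ} (h : IsUGES A B K W μ) {z : ℂ} (hz0 : z ≠ 0)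
    (hz : z ∈ spectrum ℂ (toComplex (laplacian W))) {s : ℂ}
    (hs : s ∈ spectrum ℂ (complexMode A B K z)) : s.re ≤ -μ := by
  obtain ⟨v, hv0, hv⟩ := mem_spectrum_iff_exists_mulVec.1 hz
  obtain ⟨w, hw0, hw⟩ := mem_spectrum_iff_exists_mulVec.1 hs
  obtain ⟨M, hM, hU⟩ := h
  obtain ⟨a, ha⟩ := Function.ne_iff.1 hw0
  -- A constant `v` would be annihilated by the Laplacian, contradicting `z ≠ 0`; so the mode really
  -- leaves the synchronization set.
  obtain ⟨i, j, hij⟩ : ∃ i j, v i ≠ v j := by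
    by_contra! hcon
    obtain ⟨r, hvr⟩ := Function.ne_iff.1 hv0
    have h1 : v = fun _ => v r := funext fun i => hcon i r
    have h2 := congrFun hv r
    rw [h1, toComplex_laplacian_mulVec_const] at h2
    exact (mul_ne_zero hz0 hvr) h2.symm
  set d : ℂ := (v i - v j) * w a with hd
  have hd0 : 0 < ‖d‖ := norm_pos_iff.2 (mul_ne_zero (sub_ne_zero.2 hij) ha)
  have hbound : ∀ c : ℂ, ∃ D : ℝ, ∀ t : ℝ, 0 ≤ t →
      |(c * Complex.exp (s * t) * d).re| ≤ D * Real.exp (-μ * t) := by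
    intro c
    have htraj := isTrajectory_mode (c := c) hv hw
    refine ⟨2 * (M * Metric.infDist (WithLp.toLp 2 fun p : Fin N × Fin n =>
      (c * Complex.exp (s * (0 : ℝ)) * (v p.1 * w p.2)).re) (syncSet N n)), fun t ht => ?_⟩
    have h1 := hU _ htraj t ht
    have h2 := abs_sub_le_infDist (WithLp.toLp 2 fun p : Fin N × Fin n =>
      (c * Complex.exp (s * t) * (v p.1 * w p.2)).re) i j a
    have h3 : c * Complex.exp (s * t) * d = c * Complex.exp (s * t) * (v i * w a) -
        c * Complex.exp (s * t) * (v j * w a) := by rw [hd]; ring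
    rw [h3, Complex.sub_re]
    refine h2.trans ((mul_le_mul_of_nonneg_left h1 zero_le_two).trans (le_of_eq ?_))
    ring
  -- The factors `1` and `-i` bound the real and imaginary parts of `exp (s t) d`, and hence its
  -- norm.
  obtain ⟨D₁, h₁⟩ := hbound 1
  obtain ⟨D₂, h₂⟩ := hbound (-Complex.I)
  by_contra! hcon
  have hall : ∀ t : ℝ, 0 ≤ t → Real.exp ((s.re + μ) * t) ≤ (D₁ + D₂) / ‖d‖ := by
    intro t ht
    have h1 := h₁ t ht
    have h2 := h₂ t ht
    have h3 : (-Complex.I * Complex.exp (s * t) * d).re = (Complex.exp (s * t) * d).im := by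
      rw [mul_assoc]; simp
    rw [one_mul] at h1
    rw [h3] at h2
    have h4 := (Complex.norm_le_abs_re_add_abs_im (Complex.exp (s * t) * d)).trans (add_le_add h1 h2)
    rw [norm_mul, Complex.norm_exp, ← add_mul, Complex.re_mul_ofReal] at h4
    rw [le_div_iff₀ hd0]
    calc Real.exp ((s.re + μ) * t) * ‖d‖ = Real.exp (s.re * t) * ‖d‖ * Real.exp (μ * t) := by
          rw [add_mul, Real.exp_add]; ring
      _ ≤ (D₁ + D₂) * Real.exp (-μ * t) * Real.exp (μ * t) := by gcongr
      _ = D₁ + D₂ := by rw [mul_assoc, ← Real.exp_add]; simp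
  have htend : Filter.Tendsto (fun t : ℝ => Real.exp ((s.re + μ) * t)) Filter.atTop Filter.atTop :=
    Real.tendsto_exp_atTop.comp (Filter.tendsto_id.const_mul_atTop (by linarith))
  obtain ⟨t, ht, ht0⟩ := ((htend.eventually_gt_atTop ((D₁ + D₂) / ‖d‖)).and
    (Filter.eventually_ge_atTop 0)).exists
  exact absurd (hall t ht0) (not_le.2 ht)

theorem IsUGES.mono {μ μ' : ℝ} (h : IsUGES A B K W μ') (hμ : μ ≤ μ') : IsUGES A B K W μ := by
  obtain ⟨M, hM, hU⟩ := h
  refine ⟨M, hM, fun x hx t ht => (hU x hx t ht).trans ?_⟩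
  gcongr
  exact Metric.infDist_nonneg

variable {ν : ℕ} {lam : Fin ν → ℂ} {μ : ℝ}

theorem ComplexCondition.exists_isUGES (hW : ∀ i j, 0 ≤ W i j) (hconn : HasSpanningTree W)
    (hlam : ListsNonzeroEigenvalues (laplacian W) lam) (h : ComplexCondition A B K lam μ) :
    ∃ μ', μ < μ' ∧ IsUGES A B K W μ' := by
  refine Synchronization.exists_isUGES hW hconn fun z hz hz0 s hs => ?_
  obtain ⟨k, rfl | rfl⟩ := hlam.2 z hz hz0
  · exact spectralAbscissa_lt_iff.1 (h k) s hs
  · simpa using spectralAbscissa_lt_iff.1 (h k) _ (conj_mem_spectrum_complexMode A B K hs)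

theorem IsUGES.spectralAbscissa_le (hlam : ListsNonzeroEigenvalues (laplacian W) lam)
    (h : IsUGES A B K W μ) (k : Fin ν) :
    spectralAbscissa (complexMode A B K (lam k)) ≤ ((-μ : ℝ) : EReal) :=
  spectralAbscissa_le_iff.2 fun _ hs => h.re_le (hlam.1 k).1 (hlam.1 k).2 hs

end Network

end Synchronization

open Synchronization
theorem proposition1 {N n m ν : ℕ}
    (A : Matrix (Fin n) (Fin n) ℝ) (B : Matrix (Fin n) (Fin m) ℝ) (K : Matrix (Fin m) (Fin n) ℝ)
    (W : Matrix (Fin N) (Fin N) ℝ) (hW : ∀ i j, 0 ≤ W i j) (hconn : HasSpanningTree W)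
    (lam : Fin ν → ℂ) (hlam : ListsNonzeroEigenvalues (laplacian W) lam)
    (μ : ℝ) (hμ : 0 < μ) :
    -- For every rate: the three conditions are equivalent to each other, and to exponential
    -- stability with some rate larger than `μ`.
    [∃ μ' : ℝ, μ < μ' ∧ IsUGES A B K W μ',
      ComplexCondition A B K lam μ,
      RealCondition A B K lam μ,
      LyapunovCondition A B K lam μ].TFAE ∧
    -- Off the boundary rate: each of them is equivalent to `μ`-UGES.
    ((((-μ : ℝ) : EReal) ≠ ⨆ k, spectralAbscissa (complexMode A B K (lam k))) →
      [IsUGES A B K W μ,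
        ComplexCondition A B K lam μ,
        RealCondition A B K lam μ,
        LyapunovCondition A B K lam μ].TFAE) := by
  constructor
  · tfae_have 1 → 2 := fun ⟨μ', hμ', h⟩ k =>
      (h.spectralAbscissa_le hlam k).trans_lt (EReal.coe_lt_coe_iff.2 (by linarith))
    tfae_have 2 → 1 := fun h => h.exists_isUGES hW hconn hlam
    tfae_have 2 → 4 := ComplexCondition.lyapunovCondition
    tfae_have 4 → 3 := LyapunovCondition.realCondition
    tfae_have 3 → 2 := RealCondition.complexCondition
    tfae_finish
  · intro hne
    tfae_have 1 → 2 := fun h k =>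
      -- `μ`-UGES only bounds the largest abscissa by `-μ`; excluding equality makes the bound
      -- strict for every mode.
      (le_iSup (fun k => spectralAbscissa (complexMode A B K (lam k))) k).trans_lt
        (lt_of_le_of_ne (iSup_le fun k => h.spectralAbscissa_le hlam k) hne.symm)
    tfae_have 2 → 1 := fun h => by
      obtain ⟨μ', hμ', h'⟩ := h.exists_isUGES hW hconn hlam
      exact h'.mono hμ'.le
    tfae_have 2 → 4 := ComplexCondition.lyapunovCondition
    tfae_have 4 → 3 := LyapunovCondition.realCondition
    tfae_have 3 → 2 := RealCondition.complexCondition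
    tfae_finish
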